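/- Let $n$ be a natural number. Let $B_n$ be the braid group on $n$ strands, i.e. the group generated by $\sigma_1,\dots,\sigma_{n-1}$ subject to the relations $\sigma_i\sigma_j\sigma_i=\sigma_j\sigma_i\sigma_j$ for $|i-j|=1$ and $\sigma_i\sigma_j=\sigma_j\sigma_i$ for $|i-j|\ge 2$, and let $B_n^+$ be the monoid with the same generators and relations. A standard word is a finite word in the letters $\sigma_i^{\pm1}$; it is positive if it contains no letter $\sigma_i^{-1}$. Then, for every $n$, there is a linear time reduction of the conjugacy decision problem on $B_n$ to a problem on positive words: there is a map, computable in $O(|U|+|V|+1)$ steps on a multi-tape Turing machine (which may depend on $n$, as may the implied constant), that sends every pair $(U,V)$ of standard words to a quadruple $(A,B,C,D)$ of positive words, such that $U$ and $V$ represent conjugate elements of $B_n$ if and only if there is a positive word $M$ such that the words $A\cdot M\cdot B$ and $C\cdot M\cdot D$ represent the same element of $B_n^+$. -/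

import Mathlib

namespace BraidReduction

/-! ### The braid group and the braid monoid on `n` strands

The generators `σ_1, …, σ_{n-1}` are indexed by `Fin (n - 1)`. For `n ≤ 1` there is no generator,
and both the braid group and the braid monoid are trivial, as they should be. -/

/-- The defining relations `σ_i σ_j σ_i = σ_j σ_i σ_j` for `|i - j| = 1` and `σ_i σ_j = σ_j σ_i` for
`|i - j| ≥ 2`, as a relation between positive words. -/
inductive BraidRel (n : ℕ) : FreeMonoid (Fin (n - 1)) → FreeMonoid (Fin (n - 1)) → Prop
  | braid (i j : Fin (n - 1)) (h : i.val + 1 = j.val) :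
      BraidRel n (.of i * .of j * .of i) (.of j * .of i * .of j)
  | comm (i j : Fin (n - 1)) (h : i.val + 2 ≤ j.val) :
      BraidRel n (.of i * .of j) (.of j * .of i)

/-- The braid monoid `B_n^+`: the monoid presented by the braid relations. -/
abbrev BraidMonoid (n : ℕ) : Type := PresentedMonoid (BraidRel n)

/-- The braid relations as elements `u * v⁻¹` of the free group. -/
def braidGroupRels (n : ℕ) : Set (FreeGroup (Fin (n - 1))) :=
  {r | ∃ u v : FreeMonoid (Fin (n - 1)), BraidRel n u v ∧
    r = FreeMonoid.lift FreeGroup.of u * (FreeMonoid.lift FreeGroup.of v)⁻¹}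

/-- The braid group `B_n`: the group presented by the braid relations. -/
abbrev BraidGroup (n : ℕ) : Type := PresentedGroup (braidGroupRels n)

/-- Standard words: words in the letters `σ_i` (written `(i, true)`) and `σ_i⁻¹` (written
`(i, false)`). They are not assumed to be reduced. -/
abbrev StdWord (n : ℕ) : Type := List (Fin (n - 1) × Bool)

/-- Positive standard words: words in the letters `σ_i`. -/
abbrev PosWord (n : ℕ) : Type := List (Fin (n - 1))

/-- The braid represented by a standard word. -/
def StdWord.toBraid {n : ℕ} (W : StdWord n) : BraidGroup n :=
  PresentedGroup.mk (braidGroupRels n) (FreeGroup.mk W)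

/-- The element of the braid monoid represented by a positive word. -/
def PosWord.toBraid {n : ℕ} (W : PosWord n) : BraidMonoid n :=
  PresentedMonoid.mk (BraidRel n) (FreeMonoid.ofList W)

/-! ### Decision problems and linear time reductions -/

/-- A decision problem: a type of instances, each written as a word over a finite alphabet in an
unambiguous way, with the predicate that singles out the instances with answer "yes". -/
structure DecisionProblem where
  /-- the instances -/
  Instance : Type
  /-- the alphabet in which instances are written -/
  Symbol : Type
  symbol_finite : Finite Symbol
  /-- how an instance is written -/
  encode : Instance → List Symbol
  encode_injective : Function.Injective encode
  /-- the question -/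
  Yes : Instance → Prop

/-- `f` is computed in linear time: a multi-tape Turing machine (with stacks as tapes), all
of whose stack alphabets are finite, given an input word of length `k`, writes the output within
`c * (k + 1)` steps, `c` a constant. -/
def LinearTimeComputable {α β αΓ βΓ : Type} (ea : α → List αΓ) (eb : β → List βΓ)
    (f : α → β) : Prop :=
  ∃ h : Turing.TM2ComputableInTime ea eb f,
    (∀ s, Finite (h.tm.Γ s)) ∧ ∃ c : ℕ, ∀ k : ℕ, h.time k ≤ c * (k + 1)

/-- There is a linear time reduction of the problem `P` to the problem `Q`: a map from instances
to instances, computable in linear time, that preserves the answer. -/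
def LinearTimeReducible (P Q : DecisionProblem) : Prop :=
  ∃ f : P.Instance → Q.Instance,
    LinearTimeComputable P.encode Q.encode f ∧ ∀ x, P.Yes x ↔ Q.Yes (f x)

/-! ### Writing tuples of words, with `none` as a separator -/

/-- Two words as one word. -/
def encodePair {γ : Type} (x : List γ × List γ) : List (Option γ) :=
  x.1.map some ++ none :: x.2.map some

/-- Four words as one word. -/
def encodeQuadruple {γ : Type} (x : List γ × List γ × List γ × List γ) : List (Option γ) :=
  x.1.map some ++ none :: (x.2.1.map some ++ none :: (x.2.2.1.map some ++
    none :: x.2.2.2.map some))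

theorem separator_cancel {γ : Type} (u u' : List γ) (s s' : List (Option γ))
    (h : u.map some ++ none :: s = u'.map some ++ none :: s') : u = u' ∧ s = s' := by
  induction u generalizing u' with
  | nil => cases u' <;> simp_all
  | cons a u ih =>
    cases u' with
    | nil => simp at h
    | cons b u' =>
      simp only [List.map_cons, List.cons_append, List.cons.injEq, Option.some.injEq] at h
      obtain ⟨h1, h2⟩ := ih u' h.2
      exact ⟨by rw [h.1, h1], h2⟩

theorem map_some_injective {γ : Type} :
    Function.Injective (List.map (some : γ → Option γ)) :=
  List.map_injective_iff.mpr (Option.some_injective γ)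

theorem encodePair_injective {γ : Type} : Function.Injective (encodePair (γ := γ)) := by
  rintro ⟨u, v⟩ ⟨u', v'⟩ h
  obtain ⟨h1, h2⟩ := separator_cancel _ _ _ _ h
  exact Prod.ext h1 (map_some_injective h2)

theorem encodeQuadruple_injective {γ : Type} :
    Function.Injective (encodeQuadruple (γ := γ)) := by
  rintro ⟨a, b, c, d⟩ ⟨a', b', c', d'⟩ h
  obtain ⟨h1, h2⟩ := separator_cancel _ _ _ _ h
  obtain ⟨h3, h4⟩ := separator_cancel _ _ _ _ h2
  obtain ⟨h5, h6⟩ := separator_cancel _ _ _ _ h4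
  exact Prod.ext h1 (Prod.ext h3 (Prod.ext h5 (map_some_injective h6)))

/-! ### The two problems -/

/-- The conjugacy decision problem on `B_n`: given two standard words `U`, `V`, do they
represent conjugate braids? -/
def conjugacyProblem (n : ℕ) : DecisionProblem where
  Instance := StdWord n × StdWord n
  Symbol := Option (Fin (n - 1) × Bool)
  symbol_finite := inferInstance
  encode := encodePair
  encode_injective := encodePair_injective
  Yes := fun x => IsConj x.1.toBraid x.2.toBraid

/-- Given four positive words `A`, `B`, `C`, `D`, is there a positive word `M` such that
`A M B` and `C M D` represent the same element of `B_n^+`? -/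
def positiveEquationProblem (n : ℕ) : DecisionProblem where
  Instance := PosWord n × PosWord n × PosWord n × PosWord n
  Symbol := Option (Fin (n - 1))
  symbol_finite := inferInstance
  encode := encodeQuadruple
  encode_injective := encodeQuadruple_injective
  Yes := fun ⟨A, B, C, D⟩ => ∃ M : PosWord n,
    PosWord.toBraid (A ++ M ++ B) = PosWord.toBraid (C ++ M ++ D)

end BraidReduction

/-! Some power of `δ = σ_1 ⋯ σ_{n-1}` is a central element `z` of `B_n^+` with `σ_i q_i = q_i σ_i =
z` for suitable positive `q_i` (`exists_central_multiple`). In `B_n` this gives `σ_i⁻¹ z = q_i`, so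
multiplying by one factor `z` per letter makes any standard word positive. With `A = U z^(|U|+|V|)`
and `D = V z^(|U|+|V|)`, conjugacy of `U` and `V` means `A c = c D` for some braid `c`, and `c` may
be taken positive because powers of `z` are central.

It remains to pass from `B_n` back to `B_n^+`. Garside's embedding theorem is not needed: inverting
`z` inverts every generator, so the localization of `B_n^+` at the powers of `z` receives a map from
`B_n`. Hence positive words equal in `B_n` agree in `B_n^+` after multiplication by some `z^N`
(`exists_pow_mul_eq_of_toGroup_eq`), and `z^N` is absorbed into `M`.

The words replacing letters are fixed once `n` is, so each is written in one machine step and the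
total time is linear. -/

namespace BraidReduction

/-! ### A central element of a monoid with braid relations -/

section Central

variable {M : Type*} [Monoid M]

/-- The product `s 0 * s 1 * ⋯ * s (k - 1)`. -/
def prefixProd (s : ℕ → M) : ℕ → M
  | 0 => 1
  | k + 1 => prefixProd s k * s k

theorem prefixProd_succ_left (s : ℕ → M) (k : ℕ) :
    prefixProd s (k + 1) = s 0 * prefixProd (fun i => s (i + 1)) k := by
  induction k with
  | zero => simp [prefixProd]
  | succ k ih => rw [prefixProd, ih, prefixProd, mul_assoc]

variable {s : ℕ → M} {m : ℕ}
  (hb : ∀ i, i + 1 < m → s i * s (i + 1) * s i = s (i + 1) * s i * s (i + 1))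
  (hc : ∀ i j, i + 2 ≤ j → j < m → s i * s j = s j * s i)

include hc in
theorem commute_prefixProd {k j : ℕ} (hkj : k < j) (hj : j < m) :
    Commute (prefixProd s k) (s j) := by
  induction k with
  | zero => exact Commute.one_left _
  | succ k ih => exact (ih (by omega)).mul_left (hc k j hkj hj)

include hb hc in
-- Moving left through the product, `s i` commutes with the factors after `s (i + 1)`, the braid
-- relation turns it into `s (i + 1)`, and that commutes with the factors before `s i`.
theorem prefixProd_mul_generator {k i : ℕ} (hk : k ≤ m) (hi : i + 1 < k) :
    prefixProd s k * s i = s (i + 1) * prefixProd s k := by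
  induction k with
  | zero => omega
  | succ k ih =>
    rcases Nat.lt_or_ge (i + 1) k with h | h
    · rw [prefixProd, mul_assoc, ← hc i k (by omega) (by omega), ← mul_assoc,
        ih (by omega) h, mul_assoc]
    · obtain rfl : k = i + 1 := by omega
      have h1 := (commute_prefixProd hc (Nat.lt_succ_self i) (by omega : i + 1 < m)).eq
      rw [prefixProd, prefixProd, mul_assoc, mul_assoc, ← mul_assoc (s i), hb i (by omega)]
      simp only [← mul_assoc]
      rw [h1]

include hb hc in
-- This closes the cycle: one factor `δ` shifts indices up by one, and `δ²` carries the last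
-- generator back to the first. In the induction, the square equals `d² s_{k+1} s_k`; a braid move
-- then exposes `d² s_k`.
theorem prefixProd_sq_mul_last {k : ℕ} (hk : k + 1 ≤ m) :
    prefixProd s (k + 1) * prefixProd s (k + 1) * s k =
      s 0 * (prefixProd s (k + 1) * prefixProd s (k + 1)) := by
  induction k with
  | zero => simp [prefixProd, mul_assoc]
  | succ k ih =>
    set d := prefixProd s (k + 1) with hd
    have h1 : s (k + 1) * d * s (k + 1) = d * s (k + 1) * s k := by
      have hcomm := (commute_prefixProd hc (Nat.lt_succ_self k) (by omega : k + 1 < m)).eq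
      rw [hd, prefixProd, ← mul_assoc, ← hcomm, mul_assoc, mul_assoc, ← mul_assoc (s (k + 1)),
        ← hb k (by omega)]
      simp only [mul_assoc]
    have h2 : prefixProd s (k + 2) * prefixProd s (k + 2) = d * d * (s (k + 1) * s k) := by
      rw [prefixProd, ← hd, mul_assoc, ← mul_assoc (s (k + 1)), h1]
      simp only [mul_assoc]
    rw [h2, mul_assoc, ← hb k (by omega)]
    calc d * d * (s k * s (k + 1) * s k) = d * d * s k * (s (k + 1) * s k) := by
          simp only [mul_assoc]
      _ = s 0 * (d * d * (s (k + 1) * s k)) := by rw [ih (by omega), mul_assoc]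

include hb hc in
theorem prefixProd_pow_mul_generator {i j : ℕ} (hij : i + j < m) :
    prefixProd s m ^ j * s i = s (i + j) * prefixProd s m ^ j := by
  induction j with
  | zero => simp
  | succ j ih =>
    rw [pow_succ', mul_assoc, ih (by omega), ← mul_assoc,
      prefixProd_mul_generator hb hc le_rfl (by omega), mul_assoc, add_assoc]

include hb hc in
theorem commute_prefixProd_pow {i : ℕ} (hi : i < m) : Commute (prefixProd s m ^ (m + 1)) (s i) := by
  obtain ⟨k, rfl⟩ : ∃ k, m = i + k + 1 := ⟨m - i - 1, by omega⟩
  set d := prefixProd s (i + k + 1) with hd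
  have h1 : d ^ k * s i = s (i + k) * d ^ k := prefixProd_pow_mul_generator hb hc (by omega)
  have h2 : d ^ 2 * s (i + k) = s 0 * d ^ 2 := by
    rw [pow_two]; exact prefixProd_sq_mul_last hb hc le_rfl
  have h3 : d ^ i * s 0 = s i * d ^ i := by
    simpa using prefixProd_pow_mul_generator hb hc (i := 0) (j := i) (by omega)
  -- Read from the right: `k` shifts take `s i` to the last generator, two factors wrap it to `s 0`,
  -- and `i` shifts bring it back to `s i`.
  have he : d ^ (i + k + 1 + 1) = d ^ i * (d ^ 2 * d ^ k) := by
    rw [← pow_add, ← pow_add]; congr 1; omega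
  change d ^ (i + k + 1 + 1) * s i = s i * d ^ (i + k + 1 + 1)
  calc _ = d ^ i * (d ^ 2 * (d ^ k * s i)) := by rw [he]; simp only [mul_assoc]
    _ = d ^ i * (d ^ 2 * s (i + k)) * d ^ k := by rw [h1]; simp only [mul_assoc]
    _ = d ^ i * s 0 * d ^ 2 * d ^ k := by rw [h2]; simp only [mul_assoc]
    _ = _ := by rw [h3, he]; simp only [mul_assoc]

include hb hc in
/-- A suitable power of `s 0 * ⋯ * s (m - 1)` commutes with every generator and is divisible by
every generator, on both sides and with the same quotient. -/
theorem exists_central_multiple :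
    ∃ z : M, ∀ i < m, Commute z (s i) ∧ ∃ q, s i * q = z ∧ q * s i = z := by
  set d := prefixProd s m with hd
  set c := d ^ (m + 1) with hcdef
  -- `c ^ 2` has a left quotient `q` and a right quotient `q'`, possibly different. Doubling the
  -- exponent makes them agree, since `c ^ 2 * q = q' * c ^ 2`.
  refine ⟨c ^ 4, fun i hi => ?_⟩
  have hcomm : Commute c (s i) := commute_prefixProd_pow hb hc hi
  obtain ⟨k, hk⟩ : ∃ k, m = i + k + 1 := ⟨m - i - 1, by omega⟩
  have hcd : c = d * d ^ m := by rw [hcdef, pow_succ']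
  have hcd' : c = d ^ m * d := by rw [hcdef, pow_succ]
  -- `δ^i s_0 = s_i δ^i` and `δ` begins with `s_0`, so `s_i` is a left divisor of `δ^(i+1)`; the
  -- remaining powers pad this to `c ^ 2`. On the right, the argument uses that `δ` ends with the
  -- last generator.
  obtain ⟨q, hq⟩ : ∃ q, s i * q = c ^ 2 := by
    have h1 : d ^ i * s 0 = s i * d ^ i := by
      simpa using prefixProd_pow_mul_generator hb hc (i := 0) (j := i) (by omega)
    obtain ⟨r, hr⟩ : ∃ r, d = s 0 * r := ⟨_, by rw [hd, hk, prefixProd_succ_left]⟩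
    refine ⟨d ^ i * r * d ^ m * d ^ (m + 1 - i), ?_⟩
    calc _ = s i * d ^ i * r * d ^ m * d ^ (m + 1 - i) := by simp only [mul_assoc]
      _ = d ^ i * (s 0 * r) * d ^ m * d ^ (m + 1 - i) := by rw [← h1]; simp only [mul_assoc]
      _ = d ^ i * d * d ^ m * d ^ (m + 1 - i) := by rw [← hr]
      _ = c ^ 2 := by
        rw [hcdef, ← pow_succ, ← pow_add, ← pow_add, ← pow_mul]; congr 1; omega
  obtain ⟨q', hq'⟩ : ∃ q', q' * s i = c ^ 2 := by
    have h1 : d ^ k * s i = s (i + k) * d ^ k := prefixProd_pow_mul_generator hb hc (by omega)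
    obtain ⟨r, hr⟩ : ∃ r, d = r * s (i + k) := ⟨prefixProd s (i + k), by rw [hd, hk, prefixProd]⟩
    refine ⟨d ^ (m + 1 - k) * d ^ m * r * d ^ k, ?_⟩
    calc _ = d ^ (m + 1 - k) * d ^ m * r * (d ^ k * s i) := by simp only [mul_assoc]
      _ = d ^ (m + 1 - k) * d ^ m * (r * s (i + k)) * d ^ k := by rw [h1]; simp only [mul_assoc]
      _ = d ^ (m + 1 - k) * d ^ m * d * d ^ k := by rw [← hr]
      _ = c ^ 2 := by
        rw [hcdef, mul_assoc _ _ d, ← pow_succ, ← pow_add, ← pow_add, ← pow_mul]; congr 1; omega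
  have h4 : c ^ 4 = c ^ 2 * c ^ 2 := by rw [← pow_add]
  have hqq : q' * c ^ 2 = c ^ 2 * q := by rw [← hq, ← mul_assoc, hq', hq]
  refine ⟨hcomm.pow_left 4, c ^ 2 * q, ?_, ?_⟩
  · rw [← mul_assoc, ← (hcomm.pow_left 2).eq, mul_assoc, hq, h4]
  · rw [← hqq, mul_assoc, (hcomm.pow_left 2).eq, ← mul_assoc, hq', h4]

end Central

/-! ### Comparing the braid monoid with the braid group -/

/-- The generators of the braid monoid. -/
def gen {n : ℕ} (i : Fin (n - 1)) : BraidMonoid n := PresentedMonoid.of (BraidRel n) i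

theorem gen_braid {n : ℕ} (i j : Fin (n - 1)) (h : i.val + 1 = j.val) :
    gen i * gen j * gen i = gen j * gen i * gen j :=
  PresentedMonoid.mk_eq_mk_of_rel (BraidRel.braid i j h)

theorem gen_comm {n : ℕ} (i j : Fin (n - 1)) (h : i.val + 2 ≤ j.val) :
    gen i * gen j = gen j * gen i :=
  PresentedMonoid.mk_eq_mk_of_rel (BraidRel.comm i j h)

theorem exists_central_gen_multiple (n : ℕ) :
    ∃ z : BraidMonoid n, ∀ i, Commute z (gen i) ∧ ∃ q, gen i * q = z ∧ q * gen i = z := by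
  let s : ℕ → BraidMonoid n := fun i => if h : i < n - 1 then gen ⟨i, h⟩ else 1
  have hs : ∀ i (h : i < n - 1), s i = gen ⟨i, h⟩ := fun i h => dif_pos h
  obtain ⟨z, hz⟩ := exists_central_multiple (s := s) (m := n - 1)
    (fun i h => by
      rw [hs i (by omega), hs (i + 1) h]; exact gen_braid _ _ rfl)
    (fun i j h hj => by
      rw [hs i (by omega), hs j hj]; exact gen_comm _ _ h)
  exact ⟨z, fun i => by simpa [hs i.1 i.2] using hz i.1 i.2⟩

namespace PosWord

variable {n : ℕ}

theorem toBraid_append (u v : PosWord n) : toBraid (u ++ v) = toBraid u * toBraid v := rfl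

theorem toBraid_nil : toBraid ([] : PosWord n) = 1 := rfl

theorem toBraid_singleton (i : Fin (n - 1)) : toBraid [i] = gen i := rfl

theorem toBraid_cons (i : Fin (n - 1)) (u : PosWord n) : toBraid (i :: u) = gen i * toBraid u := rfl

theorem toBraid_surjective :
    Function.Surjective (toBraid : PosWord n → BraidMonoid n) := fun x => by
  obtain ⟨w, rfl⟩ := PresentedMonoid.surjective_mk x
  exact ⟨FreeMonoid.toList w, rfl⟩

theorem toBraid_flatten_replicate (k : ℕ) (t : PosWord n) :
    toBraid (List.replicate k t).flatten = toBraid t ^ k := by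
  induction k with
  | zero => rfl
  | succ k ih => rw [List.replicate_succ, List.flatten_cons, toBraid_append, ih, pow_succ']

end PosWord

theorem commute_of_commute_gen {n : ℕ} {z : BraidMonoid n} (hz : ∀ i, Commute z (gen i))
    (x : BraidMonoid n) : Commute z x := by
  obtain ⟨w, rfl⟩ := PosWord.toBraid_surjective x
  induction w with
  | nil => exact Commute.one_right z
  | cons i w ih => exact (hz i).mul_right ih

/-- The canonical homomorphism from the braid monoid to the braid group. -/
def toGroup (n : ℕ) : BraidMonoid n →* BraidGroup n :=
  PresentedMonoid.lift (fun i => PresentedGroup.of i) (by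
    intro u v h
    have key : ∀ w : FreeMonoid (Fin (n - 1)),
        FreeMonoid.lift (fun i => (PresentedGroup.of i : BraidGroup n)) w =
          PresentedGroup.mk (braidGroupRels n) (FreeMonoid.lift FreeGroup.of w) := fun w =>
      DFunLike.congr_fun (FreeMonoid.hom_eq (f := FreeMonoid.lift _)
        (g := (PresentedGroup.mk (braidGroupRels n)).comp (FreeMonoid.lift FreeGroup.of))
        (fun i => by simp [PresentedGroup.of])) w
    rw [key, key, ← mul_inv_eq_one, ← map_inv, ← map_mul]
    exact PresentedGroup.one_of_mem ⟨u, v, h, rfl⟩)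

theorem toGroup_gen {n : ℕ} (i : Fin (n - 1)) : toGroup n (gen i) = PresentedGroup.of i := by
  simp [toGroup, gen]

/-- Every submonoid of the center is an Ore set. -/
@[reducible]
def oreSetOfCentral {R : Type*} [Monoid R] (S : Submonoid R) (hS : ∀ s ∈ S, ∀ r : R, Commute s r) :
    OreLocalization.OreSet S where
  ore_right_cancel r₁ r₂ s h := ⟨s, by rw [(hS s s.2 r₁).eq, (hS s s.2 r₂).eq, h]⟩
  oreNum r _ := r
  oreDenom _ s := s
  ore_eq r s := (hS s s.2 r).eq

/-- If a central element is a multiple of all generators, then two positive braids that are equal in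
the braid group become equal in the braid monoid after multiplication by one of its powers. -/
theorem exists_pow_mul_eq_of_toGroup_eq {n : ℕ} {z : BraidMonoid n}
    (hz : ∀ i, Commute z (gen i) ∧ ∃ q, gen i * q = z ∧ q * gen i = z) {x y : BraidMonoid n}
    (h : toGroup n x = toGroup n y) : ∃ N, z ^ N * x = z ^ N * y := by
  have hcen := commute_of_commute_gen fun i => (hz i).1
  let S := Submonoid.powers z
  have hS : ∀ s ∈ S, ∀ r, Commute s r := by
    rintro _ ⟨k, rfl⟩ r
    exact (hcen r).pow_left k
  let _ := oreSetOfCentral S hS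
  let φ : BraidMonoid n →* OreLocalization S (BraidMonoid n) := OreLocalization.numeratorHom
  -- A factor of a unit is a unit when the two factors commute; this is where the equality of the
  -- left and right quotients is used.
  have hunit : ∀ i, IsUnit (φ (gen i)) := fun i => by
    obtain ⟨q, h1, h2⟩ := (hz i).2
    have hc : Commute (φ (gen i)) (φ q) := by
      rw [Commute, SemiconjBy, ← map_mul, ← map_mul, h1, h2]
    refine (hc.isUnit_mul_iff.mp ?_).1
    rw [← map_mul, h1]
    exact OreLocalization.numerator_isUnit (⟨z, Submonoid.mem_powers z⟩ : S)
  let u : Fin (n - 1) → (OreLocalization S (BraidMonoid n))ˣ := fun i => (hunit i).unit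
  have hval : ∀ w : FreeMonoid (Fin (n - 1)),
      ((FreeGroup.lift u (FreeMonoid.lift FreeGroup.of w) :
        (OreLocalization S (BraidMonoid n))ˣ) : OreLocalization S (BraidMonoid n)) =
        φ (PresentedMonoid.mk (BraidRel n) w) := fun w =>
    DFunLike.congr_fun (FreeMonoid.hom_eq
      (f := (Units.coeHom _).comp ((FreeGroup.lift u).comp (FreeMonoid.lift FreeGroup.of)))
      (g := φ.comp (PresentedMonoid.mk (BraidRel n)))
      (fun i => by simp [u]; rfl)) w
  have hrel : ∀ r ∈ braidGroupRels n, FreeGroup.lift u r = 1 := by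
    rintro _ ⟨v, w, hvw, rfl⟩
    rw [map_mul, map_inv, mul_inv_eq_one]
    ext
    rw [hval, hval]
    exact congrArg φ (PresentedMonoid.mk_eq_mk_of_rel hvw)
  -- The localization map factors through the braid group, so it cannot separate `x` from `y`.
  have hfac : ∀ a, ((PresentedGroup.toGroup hrel (toGroup n a) :
      (OreLocalization S (BraidMonoid n))ˣ) : OreLocalization S (BraidMonoid n)) = φ a := by
    intro a
    obtain ⟨w, rfl⟩ := PosWord.toBraid_surjective a
    induction w with
    | nil => simp [PosWord.toBraid_nil]
    | cons i w ih =>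
      rw [PosWord.toBraid_cons, map_mul, map_mul, Units.val_mul, ih, map_mul, toGroup_gen,
        PresentedGroup.toGroup.of]
      rfl
  have hφ : φ x = φ y := by rw [← hfac x, ← hfac y, h]
  -- Both denominators are `1`, so the two multipliers coincide, and their common value is a power
  -- of `z`.
  obtain ⟨a, b, h1, h2⟩ := OreLocalization.oreDiv_eq_iff.mp hφ
  obtain ⟨N, hN⟩ := a.2
  refine ⟨N, ?_⟩
  simp only [OneMemClass.coe_one, mul_one] at h2
  rw [← h2] at h1
  have hN' : z ^ N = (a : BraidMonoid n) := hN
  rw [hN']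
  exact h1.symm

/-! ### Replacing words by positive words -/

/-- Replace the letters of two words by words, and append as many copies of the word `t` to either of
the results as the other word has letters. The four words are the outer words `A`, `D`, with
two empty words in between. -/
def replacePair {L G : Type} (t : List G) (w : L → List G) (x : List L × List L) :
    List G × List G × List G × List G :=
  (x.1.flatMap w ++ (List.replicate x.2.length t).flatten, [], [],
    x.2.flatMap w ++ (List.replicate x.1.length t).flatten)

/-- `t` is a positive word that represents a central braid, and `w` replaces each letter by a
positive word that represents the product of the letter and `t`. -/
structure PositiveReplacement (n : ℕ) where
  /-- the central word -/
  t : PosWord n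
  /-- the replacement of a letter -/
  w : Fin (n - 1) × Bool → PosWord n
  hz : ∀ i, Commute t.toBraid (gen i) ∧ ∃ q, gen i * q = t.toBraid ∧ q * gen i = t.toBraid
  toGroup_w : ∀ x, toGroup n (PosWord.toBraid (w x)) = StdWord.toBraid [x] * toGroup n t.toBraid

theorem StdWord.toBraid_append {n : ℕ} (U V : StdWord n) :
    StdWord.toBraid (U ++ V) = StdWord.toBraid U * StdWord.toBraid V := by
  simp only [StdWord.toBraid, ← map_mul, FreeGroup.mul_mk]

/-- A positive letter is followed by `t`; the inverse of `σ_i` becomes a word for the quotient of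
`z` by `σ_i`. -/
theorem nonempty_positiveReplacement (n : ℕ) : Nonempty (PositiveReplacement n) := by
  obtain ⟨z, hz⟩ := exists_central_gen_multiple n
  obtain ⟨t, rfl⟩ := PosWord.toBraid_surjective z
  choose q hq using fun i => (hz i).2
  choose q' hq' using fun i => PosWord.toBraid_surjective (q i)
  refine ⟨⟨t, fun x => if x.2 then x.1 :: t else q' x.1, hz, ?_⟩⟩
  rintro ⟨i, b⟩
  cases b
  · have h1 : StdWord.toBraid [(i, false)] = (toGroup n (gen i))⁻¹ := by
      rw [toGroup_gen]; rfl
    simp only [Bool.false_eq_true, if_false]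
    rw [h1, hq', ← (hq i).1, map_mul, inv_mul_cancel_left]
  · have h1 : StdWord.toBraid [(i, true)] = toGroup n (gen i) := by
      rw [toGroup_gen]; rfl
    simp only [if_true]
    rw [h1, PosWord.toBraid_cons, map_mul]

/-! ### Correctness of the reduction -/

namespace PositiveReplacement

variable {n : ℕ} (R : PositiveReplacement n)

theorem commute_t (x : BraidMonoid n) : Commute R.t.toBraid x :=
  commute_of_commute_gen (fun i => (R.hz i).1) x

theorem commute_toGroup_t (g : BraidGroup n) : Commute (toGroup n R.t.toBraid) g := by
  obtain ⟨w, rfl⟩ := PresentedGroup.mk_surjective _ g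
  induction w using FreeGroup.induction_on with
  | C1 => simp
  | of i =>
    have := ((R.commute_t (gen i)).map (toGroup n))
    rwa [toGroup_gen] at this
  | inv_of i h => rw [map_inv]; exact h.inv_right
  | mul x y hx hy => rw [map_mul]; exact hx.mul_right hy

theorem toGroup_flatMap (U : StdWord n) : toGroup n (PosWord.toBraid (U.flatMap R.w)) =
    U.toBraid * toGroup n R.t.toBraid ^ U.length := by
  induction U with
  | nil =>
    rw [List.flatMap_nil, PosWord.toBraid_nil, map_one, List.length_nil, pow_zero, mul_one]; rfl
  | cons x U ih =>
    have h := ((R.commute_toGroup_t (StdWord.toBraid U))).eq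
    rw [List.flatMap_cons, PosWord.toBraid_append, map_mul, ih, R.toGroup_w, List.length_cons,
      pow_succ', ← mul_assoc, mul_assoc _ _ (StdWord.toBraid U), h,
      show x :: U = [x] ++ U from rfl, StdWord.toBraid_append]
    simp only [mul_assoc]

/-- The reduction on instances. -/
def reduce (x : StdWord n × StdWord n) : PosWord n × PosWord n × PosWord n × PosWord n :=
  replacePair R.t R.w x

/-- The padding by the length of the other word gives both sides the same central factor `τ ^ (|U| +
|V|)`, which cancels from the conjugacy equation. -/
theorem isConj_iff_reduce (x : StdWord n × StdWord n) :
    (conjugacyProblem n).Yes x ↔ (positiveEquationProblem n).Yes (R.reduce x) := by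
  obtain ⟨U, V⟩ := x
  change IsConj U.toBraid V.toBraid ↔ ∃ M : PosWord n,
    PosWord.toBraid (U.flatMap R.w ++ (List.replicate V.length R.t).flatten ++ M ++ []) =
      PosWord.toBraid ([] ++ M ++ (V.flatMap R.w ++ (List.replicate U.length R.t).flatten))
  simp only [List.append_nil, List.nil_append, PosWord.toBraid_append,
    PosWord.toBraid_flatten_replicate]
  set τ := toGroup n R.t.toBraid with hτ
  have hA : toGroup n (PosWord.toBraid (U.flatMap R.w) * PosWord.toBraid R.t ^ V.length) =
      U.toBraid * τ ^ (U.length + V.length) := by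
    rw [map_mul, R.toGroup_flatMap, map_pow, mul_assoc, pow_add]
  have hD : toGroup n (PosWord.toBraid (V.flatMap R.w) * PosWord.toBraid R.t ^ U.length) =
      V.toBraid * τ ^ (U.length + V.length) := by
    rw [map_mul, R.toGroup_flatMap, map_pow, mul_assoc, ← pow_add, add_comm V.length]
  have hτc : ∀ (k : ℕ) (g : BraidGroup n), Commute (τ ^ k) g := fun k g =>
    (R.commute_toGroup_t g).pow_left k
  constructor
  · intro h
    obtain ⟨c, hc⟩ := isConj_iff.mp h.symm
    obtain ⟨W, rfl⟩ : ∃ W : StdWord n, W.toBraid = c := by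
      obtain ⟨w, rfl⟩ := PresentedGroup.mk_surjective _ c
      exact ⟨w.toWord, by rw [StdWord.toBraid, FreeGroup.mk_toWord]⟩
    set m := PosWord.toBraid (W.flatMap R.w) with hm
    have hgm : toGroup n m = W.toBraid * τ ^ W.length := R.toGroup_flatMap W
    have hc' : U.toBraid * W.toBraid = W.toBraid * V.toBraid := by
      rw [← hc, inv_mul_cancel_right]
    obtain ⟨N, hN⟩ := exists_pow_mul_eq_of_toGroup_eq R.hz
      (x := PosWord.toBraid (U.flatMap R.w) * PosWord.toBraid R.t ^ V.length * m)
      (y := m * (PosWord.toBraid (V.flatMap R.w) * PosWord.toBraid R.t ^ U.length)) (by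
        rw [map_mul, map_mul _ m, hA, hD, hgm, mul_assoc, (hτc _ _).eq, ← mul_assoc, ← mul_assoc,
          hc', mul_assoc W.toBraid (τ ^ _), (hτc W.length _).eq]
        simp only [mul_assoc, ← pow_add, add_comm])
    -- The factor `t ^ N` needed to descend to the monoid is central, so it can be moved into the
    -- middle word.
    obtain ⟨M, hM⟩ := PosWord.toBraid_surjective (PosWord.toBraid R.t ^ N * m)
    refine ⟨M, ?_⟩
    rw [hM, ← mul_assoc _ (_ ^ N), ← ((R.commute_t _).pow_left N).eq, mul_assoc, hN, mul_assoc]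
  · rintro ⟨M, hM⟩
    have h := congrArg (toGroup n) hM
    rw [map_mul, map_mul _ (PosWord.toBraid M), hA, hD, mul_assoc, (hτc _ _).eq, ← mul_assoc,
      ← mul_assoc, mul_left_inj] at h
    refine (isConj_iff.mpr ⟨toGroup n (PosWord.toBraid M), ?_⟩).symm
    rw [← h, mul_inv_cancel_right]

end PositiveReplacement


/-! ### A machine that computes the reduction -/

namespace ReplacementMachine

open Turing StateTransition

/-- The stacks of the machine. -/
inductive Stack
  | input
  | work
  | output
  deriving DecidableEq

instance : Fintype Stack := ⟨{.input, .work, .output}, fun s => by cases s <;> simp⟩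

/-- The labels of the machine: it moves the two input words to the work stack (`readU`, `readV`),
moves the second word to the output (`writeV`, `emitV`), writes the central words in front of
it (`flush`), and then the first word (`writeU`, `emitU`). -/
inductive Label (L : Type)
  | readU
  | readV
  | writeV
  | emitV (x : L)
  | flush
  | writeU
  | emitU (x : L)

instance {L : Type} [Finite L] : Finite (Label L) := by
  refine Finite.of_injective (β := Fin 7 × Option L) (fun l => match l with
    | .readU => (0, none)
    | .readV => (1, none)
    | .writeV => (2, none)
    | .emitV x => (3, some x)
    | .flush => (4, none)
    | .writeU => (5, none)
    | .emitU x => (6, some x)) ?_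
  intro a b h
  cases a <;> cases b <;> simp_all

/-! ### The program and its action on the stacks -/

section

variable (L G : Type)

/-- The stack alphabets: the input and the work stack hold letters and separators of the input
alphabet, the output stack those of the output alphabet. -/
abbrev Alphabet : Stack → Type
  | .input => Option L
  | .work => Option L
  | .output => Option G

/-- The internal state holds the symbol that was popped last. -/
abbrev Register : Type := Option (Option L)

/-- Statements of the machine. -/
abbrev Statement : Type := TM2.Stmt (Alphabet L G) (Label L) (Register L)

variable {L G}

/-- Push the word `u`, reversed, on the output stack. -/
def pushRev (u : List (Option G)) (q : Statement L G) : Statement L G :=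
  u.foldr (fun g q => .push .output (fun _ => g) q) q

/-- Write the word `u` in front of the contents of the output stack. -/
def pushWord (u : List G) (q : Statement L G) : Statement L G :=
  pushRev (u.map some).reverse q

/-- Pop a symbol into the register. -/
def popInput (q : Statement L G) : Statement L G := .pop .input (fun _ a => a) q

/-- Pop a symbol into the register. -/
def popWork (q : Statement L G) : Statement L G := .pop .work (fun _ a => a) q

/-- The program. -/
def program (t : List G) (w : L → List G) : Label L → Statement L G
  -- The output is built from its end, so the copies of `t` closing `D`, one per letter of `U`, come
  -- first. The separator also goes to the work stack, where it keeps `U` and `V` apart.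
  | .readU => popInput <| .push .work (fun v => v.getD none) <|
      .branch (fun v => v.join.isSome) (pushWord t (.goto fun _ => .readU)) (.goto fun _ => .readV)
  | .readV => popInput <| .branch (fun v => v.isSome)
      (.push .work (fun v => v.getD none) (.goto fun _ => .readV)) (.goto fun _ => .writeV)
  -- The input stack, now empty, serves as a unary counter for `|V|`, read by `flush`. The letter
  -- passes from the register to the label because the statement that writes `w x` depends on it.
  | .writeV => popWork <| .branch (fun v => v.join.isSome)
      (.push .input (fun _ => none) (.goto fun v => v.join.elim .writeV .emitV))
      -- Three consecutive separators delimit the empty words `B` and `C`.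
      (pushRev [none, none, none] (.goto fun _ => .flush))
  | .emitV x => pushWord (w x) (.goto fun _ => .writeV)
  | .flush => popInput <| .branch (fun v => v.isSome)
      (pushWord t (.goto fun _ => .flush)) (.goto fun _ => .writeU)
  | .writeU => popWork <| .branch (fun v => v.isSome)
      (.goto fun v => v.join.elim .writeU .emitU) .halt
  | .emitU x => pushWord (w x) (.goto fun _ => .writeU)

/-- The contents of the stacks. -/
def contents (i k : List (Option L)) (o : List (Option G)) : ∀ s, List (Alphabet L G s)
  | .input => i
  | .work => k
  | .output => o

variable (i k : List (Option L)) (o : List (Option G))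

@[simp] theorem contents_input : contents i k o .input = i := rfl
@[simp] theorem contents_work : contents i k o .work = k := rfl
@[simp] theorem contents_output : contents i k o .output = o := rfl

@[simp] theorem update_input (i' : List (Option L)) :
    Function.update (contents i k o) .input i' = contents i' k o := by
  funext s; cases s <;> rfl

@[simp] theorem update_work (k' : List (Option L)) :
    Function.update (contents i k o) .work k' = contents i k' o := by
  funext s; cases s <;> rfl

@[simp] theorem update_output (o' : List (Option G)) :
    Function.update (contents i k o) .output o' = contents i k o' := by
  funext s; cases s <;> rfl

@[simp] theorem stepAux_pushRev (u : List (Option G)) (q : Statement L G) (v : Register L) :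
    TM2.stepAux (pushRev u q) v (contents i k o) = TM2.stepAux q v (contents i k (u.reverse ++ o)) := by
  induction u generalizing o with
  | nil => rfl
  | cons g u ih =>
    have h := ih (g :: o)
    simp only [pushRev] at h
    simp only [pushRev, List.foldr_cons, TM2.stepAux, contents_output, update_output, h,
      List.reverse_cons, List.append_assoc, List.singleton_append]

@[simp] theorem stepAux_pushWord (u : List G) (q : Statement L G) (v : Register L) :
    TM2.stepAux (pushWord u q) v (contents i k o) =
      TM2.stepAux q v (contents i k (u.map some ++ o)) := by
  simp [pushWord]

@[simp] theorem stepAux_popInput (q : Statement L G) (v : Register L) :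
    TM2.stepAux (popInput q) v (contents i k o) = TM2.stepAux q i.head? (contents i.tail k o) := by
  simp [popInput]

@[simp] theorem stepAux_popWork (q : Statement L G) (v : Register L) :
    TM2.stepAux (popWork q) v (contents i k o) = TM2.stepAux q k.head? (contents i k.tail o) := by
  simp [popWork]

end

/-- Reaching a configuration in a given number of steps. -/
def ReachesIn {C : Type} (f : C → Option C) (m : ℕ) (a b : C) : Prop :=
  (flip bind f)^[m] (some a) = some b

theorem ReachesIn.single {C : Type} {f : C → Option C} {a b : C} (h : f a = some b) :
    ReachesIn f 1 a b := h

theorem ReachesIn.trans {C : Type} {f : C → Option C} {m m' : ℕ} {a b c : C}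
    (h : ReachesIn f m a b) (h' : ReachesIn f m' b c) : ReachesIn f (m + m') a c := by
  unfold ReachesIn at *
  rw [Nat.add_comm, Function.iterate_add_apply, h, h']

/-! ### Step counts of the phases -/

section

variable {L G : Type} (t : List G) (w : L → List G)

/-- The configuration with a given label, register and contents of the stacks. -/
abbrev config (l : Option (Label L)) (v : Register L) (i k : List (Option L))
    (o : List (Option G)) : TM2.Cfg (Alphabet L G) (Label L) (Register L) :=
  ⟨l, v, contents i k o⟩

theorem readU_reaches (U : List L) (v : Register L) (i k : List (Option L)) (o : List (Option G)) :
    ReachesIn (TM2.step (program t w)) (U.length + 1)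
      (config (some .readU) v (U.map some ++ none :: i) k o)
      (config (some .readV) (some none) i (none :: (U.reverse.map some ++ k))
        ((List.replicate U.length t).flatten.map some ++ o)) := by
  induction U generalizing v k o with
  | nil => exact ReachesIn.single (by simp [program, TM2.step])
  | cons x U ih =>
    have h := ih (some (some x)) (some x :: k) (t.map some ++ o)
    have h1 : (List.replicate (x :: U).length t).flatten =
        (List.replicate U.length t).flatten ++ t := by
      rw [List.length_cons, List.replicate_succ', List.flatten_concat]
    rw [h1, List.length_cons, Nat.add_comm (U.length + 1)]
    refine (ReachesIn.single (b := config (some .readU) (some (some x)) (U.map some ++ none :: i)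
      (some x :: k) (t.map some ++ o)) (by simp [program, TM2.step])).trans ?_
    simpa using h

theorem readV_reaches (V : List L) (v : Register L) (k : List (Option L)) (o : List (Option G)) :
    ReachesIn (TM2.step (program t w)) (V.length + 1)
      (config (some .readV) v (V.map some) k o)
      (config (some .writeV) none [] (V.reverse.map some ++ k) o) := by
  induction V generalizing v k with
  | nil => exact ReachesIn.single (by simp [program, TM2.step])
  | cons x V ih =>
    rw [List.length_cons, Nat.add_comm (V.length + 1)]
    refine (ReachesIn.single (b := config (some .readV) (some (some x)) (V.map some)
      (some x :: k) o) (by simp [program, TM2.step])).trans ?_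
    simpa using ih (some (some x)) (some x :: k)

/-- Each letter costs two steps, one to pop it and one to write its replacement; the last step
handles the separator. The work stack yields the letters in reverse, and writing in front restores
their order. -/
theorem writeV_reaches (V : List L) (v : Register L) (i k : List (Option L))
    (o : List (Option G)) :
    ReachesIn (TM2.step (program t w)) (2 * V.length + 1)
      (config (some .writeV) v i (V.map some ++ none :: k) o)
      (config (some .flush) (some none) (List.replicate V.length none ++ i) k
        (none :: none :: none :: ((V.reverse.flatMap w).map some ++ o))) := by
  induction V generalizing v i o with
  | nil => exact ReachesIn.single (by simp [program, TM2.step])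
  | cons x V ih =>
    rw [List.length_cons, show 2 * (V.length + 1) + 1 = 1 + (1 + (2 * V.length + 1)) by omega]
    refine (ReachesIn.single (b := config (some (.emitV x)) (some (some x)) (none :: i)
      (V.map some ++ none :: k) o) (by simp [program, TM2.step])).trans
      ((ReachesIn.single (b := config (some .writeV) (some (some x)) (none :: i)
      (V.map some ++ none :: k) ((w x).map some ++ o)) (by simp [program, TM2.step])).trans ?_)
    have h := ih (some (some x)) (none :: i) ((w x).map some ++ o)
    rw [List.replicate_succ', List.append_assoc]
    simpa using h

theorem flush_reaches (m : ℕ) (v : Register L) (k : List (Option L)) (o : List (Option G)) :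
    ReachesIn (TM2.step (program t w)) (m + 1)
      (config (some .flush) v (List.replicate m none) k o)
      (config (some .writeU) none [] k ((List.replicate m t).flatten.map some ++ o)) := by
  induction m generalizing v o with
  | zero => exact ReachesIn.single (by simp [program, TM2.step])
  | succ m ih =>
    rw [Nat.add_comm (m + 1), List.replicate_succ' (a := t), List.flatten_concat]
    refine (ReachesIn.single (b := config (some .flush) (some none) (List.replicate m none) k
      (t.map some ++ o)) (by simp [program, TM2.step, List.replicate_succ])).trans ?_
    simpa using ih (some none) (t.map some ++ o)

theorem writeU_reaches (U : List L) (v : Register L) (o : List (Option G)) :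
    ReachesIn (TM2.step (program t w)) (2 * U.length + 1)
      (config (some .writeU) v [] (U.map some) o)
      (config none none [] [] ((U.reverse.flatMap w).map some ++ o)) := by
  induction U generalizing v o with
  | nil => exact ReachesIn.single (by simp [program, TM2.step])
  | cons x U ih =>
    rw [List.length_cons, show 2 * (U.length + 1) + 1 = 1 + (1 + (2 * U.length + 1)) by omega]
    refine (ReachesIn.single (b := config (some (.emitU x)) (some (some x)) []
      (U.map some) o) (by simp [program, TM2.step])).trans
      ((ReachesIn.single (b := config (some .writeU) (some (some x)) []
      (U.map some) ((w x).map some ++ o)) (by simp [program, TM2.step])).trans ?_)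
    simpa using ih (some (some x)) ((w x).map some ++ o)

/-- The five phases take `|U| + 1`, `|V| + 1`, `2|V| + 1`, `|V| + 1` and `2|U| + 1` steps. -/
theorem program_reaches (x : List L × List L) :
    ReachesIn (TM2.step (program t w)) (3 * x.1.length + 4 * x.2.length + 5)
      (config (some .readU) none (encodePair x) [] [])
      (config none none [] [] (encodeQuadruple (replacePair t w x))) := by
  obtain ⟨U, V⟩ := x
  have h1 := readU_reaches t w U none (V.map some) [] []
  have h2 := readV_reaches t w V (some none) (none :: (U.reverse.map some ++ []))
    ((List.replicate U.length t).flatten.map some ++ [])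
  have h3 := writeV_reaches t w V.reverse none [] (U.reverse.map some ++ [])
    ((List.replicate U.length t).flatten.map some ++ [])
  simp only [List.append_nil] at h1 h2 h3
  have h4 := flush_reaches t w V.reverse.length (some none) (U.reverse.map some) (none :: none ::
    none :: ((V.reverse.reverse.flatMap w).map some ++
      (List.replicate U.length t).flatten.map some))
  have h5 := writeU_reaches t w U.reverse none
    ((List.replicate V.reverse.length t).flatten.map some ++ (none :: none ::
    none :: ((V.reverse.reverse.flatMap w).map some ++
      (List.replicate U.length t).flatten.map some)))
  have h := (((h1.trans h2).trans h3).trans h4).trans h5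
  convert h using 1
  · simp only [List.length_reverse]; omega
  · rfl
  · simp [encodeQuadruple, replacePair]

variable [Finite L]

open Classical in
/-- The machine. -/
noncomputable def machine : FinTM2 :=
  letI := Fintype.ofFinite L
  letI := Fintype.ofFinite (Label L)
  { K := Stack
    k₀ := .input
    k₁ := .output
    Γ := Alphabet L G
    Λ := Label L
    main := .readU
    σ := Register L
    initialState := none
    Γk₀Fin := inferInstanceAs (Fintype (Option L))
    m := program t w }

theorem initList_machine (s : List (Option L)) :
    initList (machine t w) s = config (some .readU) none s [] [] := by
  refine congrArg (TM2.Cfg.mk _ _) ?_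
  funext k
  cases k <;> rfl

theorem haltList_machine (s : List (Option G)) :
    haltList (machine t w) s = config none none [] [] s := by
  refine congrArg (TM2.Cfg.mk _ _) ?_
  funext k
  cases k <;> rfl

theorem linearTimeComputable_replacePair [Finite G] :
    LinearTimeComputable encodePair encodeQuadruple (replacePair t w) := by
  refine ⟨{
    tm := machine t w
    inputAlphabet := Equiv.refl (Option L)
    outputAlphabet := Equiv.refl (Option G)
    -- The input length is `k = |U| + |V| + 1`, so `3|U| + 4|V| + 5` is at most `5 * (k + 1)`.
    time := fun k => 5 * (k + 1)
    outputsFun := fun x =>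
      { steps := 3 * x.1.length + 4 * x.2.length + 5
        evals_in_steps := ?_
        steps_le_m := ?_ } }, ?_, 5, fun k => le_rfl⟩
  · have h := program_reaches t w x
    rw [← initList_machine t w, ← haltList_machine t w] at h
    have hmap : ∀ {γ : Type} (l : List γ), List.map (Equiv.refl γ).invFun l = l :=
      fun l => List.map_id l
    have e1 := congrArg (initList (machine t w)) (hmap (encodePair x))
    have e2 := congrArg (haltList (machine t w)) (hmap (encodeQuadruple (replacePair t w x)))
    unfold ReachesIn at h
    exact (congrArg (fun c => (flip bind (machine t w).step)^[_] (some c)) e1).trans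
      (h.trans (congrArg some e2.symm))
  · simp only [encodePair, List.length_append, List.length_map, List.length_cons]
    omega
  · rintro (_ | _ | _)
    · exact inferInstanceAs (Finite (Option L))
    · exact inferInstanceAs (Finite (Option L))
    · exact inferInstanceAs (Finite (Option G))

end

end ReplacementMachine

end BraidReduction

/-- For every `n`, the conjugacy decision problem on `B_n` reduces in linear time to the problem
"given positive words `A, B, C, D`, is there a positive word `M` with `A M B ≡ C M D` in
`B_n^+`?". -/
theorem theorem6 (n : ℕ) :
    BraidReduction.LinearTimeReducible (BraidReduction.conjugacyProblem n)
      (BraidReduction.positiveEquationProblem n) := by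
  obtain ⟨R⟩ := BraidReduction.nonempty_positiveReplacement n
  exact ⟨R.reduce, BraidReduction.ReplacementMachine.linearTimeComputable_replacePair R.t R.w,
    R.isConj_iff_reduce⟩
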